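/- \textbf{Setting.} Let $S\subseteq\mathbb{R}^d$ be a non-empty convex set and let $f$ be a real function with domain $\overline S$ that is a Bregman function with zone $S$. That is, $f$ is continuous and strictly convex on $\overline S$, it is differentiable at the points of $S$ with $\nabla f$ continuous on $S$, and, with $D_f(x,y)=f(x)-f(y)-\langle\nabla f(y),x-y\rangle$: (1) for all $\alpha\in\mathbb{R}$, $x\in\overline S$, $y\in S$ the sets $\{x'\in\overline S: D_f(x',y)\le\alpha\}$ and $\{y'\in S: D_f(x,y')\le\alpha\}$ are bounded; (2) if $y_n\in S$ and $y_n\to y^*$, then $D_f(y^*,y_n)\to0$; (3) if $x_n\in\overline S$ is bounded, $y_n\in S$, $y_n\to y^*$ and $D_f(x_n,y_n)\to0$, then $x_n\to y^*$. Let $H_i=\{x:\langle a_i,x\rangle\le b_i\}$ ($a_i\ne0$) be a finite family of half-spaces and $C=\bigcap_iH_i$. Assume that every bounding hyperplane $\{\langle a_i,x\rangle=b_i\}$ is strongly zone consistent: for every $y\in S$ and every parallel hyperplane $K$ between $y$ and it, the minimizer of $D_f(\cdot,y)$ over $K\cap\overline S$ (if it exists) lies in $S$. Let $x^*$ be the minimizer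 of $f$ over $C\cap\overline S$. Constraint $i$ is \emph{active} if $\langle a_i,x^*\rangle=b_i$ and \emph{inactive} if $\langle a_i,x^*\rangle<b_i$. \textbf{Algorithm.} Start with $x^0\in S$ such that $\nabla f(x^0)=0$, $z^0=0$ and $L^0=\emptyset$. In iteration $\nu=0,1,2,\dots$, query an oracle at the current iterate $x^\nu$ to get a finite set $\mathcal L^\nu$ of constraints. Go once, in any order, through the constraints $i\in L^\nu\cup\mathcal L^\nu$, and for each do a projection step on the current pair $(x,z)$: find $p\in S$ and $\theta\in\mathbb{R}$ with $\nabla f(p)-\nabla f(x)=\theta a_i$ and $\langle a_i,p\rangle=b_i$; put $c=\min(z_i,\theta)$; replace $x$ by the point $x'\in S$ with $\nabla f(x')-\nabla f(x)=c\,a_i$, and $z_i$ by $z_i-c$. The result is $(x^{\nu+1},z^{\nu+1})$, and $L^{\nu+1}$ is the set of those $i\in L^\nu\cup\mathcal L^\nu$ with $z_i^{\nu+1}\neq0$ (the remembered constraints). \textbf{Oracles.} A \emph{deterministic separation oracle} is a map $Q$ from $\mathbb{R}^d$ to sets of constraints for which there is a continuous non-decreasing $\phi$ on $[0,\infty)$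 with $\phi(0)=0$ and $\phi(t)>0$ for $t>0$, such that for every $x$ either $x\in C$ or some $i\in Q(x)$ has $\operatorname{dist}(x,H_i)\ge\phi(\operatorname{dist}(x,C))$; here $\mathcal L^\nu=Q(x^\nu)$. A \emph{random separation oracle} assigns to each $x\in\mathbb{R}^d$ a probability distribution $Q(x)$ on sets of constraints such that, for some $\tau>0$, each constraint belongs to the returned set with probability at least $\tau$, for every input $x$; here, given the past of the execution up to and including $x^\nu$, the set $\mathcal L^\nu$ has the distribution $Q(x^\nu)$. \textbf{Proposition.} For every execution with a deterministic separation oracle, and with probability $1$ for every execution with a random separation oracle: (a) for every inactive constraint $i$ there is $N$ such that in all iterations $\nu\ge N$ we have $z_i=0$ at the start of the iteration and after every projection step, $i\notin L^\nu$, and every projection step for constraint $i$ leaves $x$ unchanged (so there is no longer any actual projection onto constraint $i$); moreover $i$ is not processed at all in such an iteration if all constraints in $\mathcal L^\nu$ are violated at $x^\nu$; (b) there is $N$ such that for all $\nu\ge N$ every remembered constraint $i\in L^\nu$ is active. -/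

import Mathlib

open Filter Topology MeasureTheory

namespace ProjectForget

/-- The decision space `ℝ^d` with its Euclidean inner product. -/
abbrev E (d : ℕ) := EuclideanSpace ℝ (Fin d)

/-- The generalized Bregman distance `D_f(x, y) = f x - f y - ⟨∇f y, x - y⟩`. -/
noncomputable def bregmanDist {d : ℕ} (f : E d → ℝ) (x y : E d) : ℝ :=
  f x - f y - inner ℝ (gradient f y) (x - y)

/-- `f` is a Bregman function with zone `S`. Its domain is `closure S`: the values of `f` elsewhere
play no role, except for the existence of the gradient at the points of `S`. -/
structure IsBregman {d : ℕ} (f : E d → ℝ) (S : Set (E d)) : Prop where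
  zone_nonempty : S.Nonempty
  zone_convex : Convex ℝ S
  continuousOn : ContinuousOn f (closure S)
  strictConvexOn : StrictConvexOn ℝ (closure S) f
  differentiableAt : ∀ y ∈ S, DifferentiableAt ℝ f y
  continuousOn_gradient : ContinuousOn (gradient f) S
  bounded_left : ∀ y ∈ S, ∀ α : ℝ,
    Bornology.IsBounded {x | x ∈ closure S ∧ bregmanDist f x y ≤ α}
  bounded_right : ∀ x ∈ closure S, ∀ α : ℝ,
    Bornology.IsBounded {y | y ∈ S ∧ bregmanDist f x y ≤ α}
  dist_tendsto : ∀ (y : ℕ → E d) (ystar : E d), (∀ n, y n ∈ S) →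
    Tendsto y atTop (𝓝 ystar) →
    Tendsto (fun n => bregmanDist f ystar (y n)) atTop (𝓝 0)
  tendsto_of_dist : ∀ (x y : ℕ → E d) (ystar : E d),
    (∀ n, x n ∈ closure S) → (∀ n, y n ∈ S) →
    Tendsto (fun n => bregmanDist f (x n) (y n)) atTop (𝓝 0) →
    Tendsto y atTop (𝓝 ystar) → Bornology.IsBounded (Set.range x) →
    Tendsto x atTop (𝓝 ystar)

/-- `p` is a Bregman projection of `y` onto `K`: a minimizer of `D_f(·, y)` over `K ∩ closure S`. -/
def IsBregmanProj {d : ℕ} (f : E d → ℝ) (S K : Set (E d)) (y p : E d) : Prop :=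
  p ∈ K ∩ closure S ∧ ∀ q ∈ K ∩ closure S, bregmanDist f p y ≤ bregmanDist f q y

/-- The hyperplane `⟨a, w⟩ = b`. -/
def hyperplane {d : ℕ} (a : E d) (b : ℝ) : Set (E d) := {w | inner ℝ a w = b}

/-- The half-space `⟨a, w⟩ ≤ b`. -/
def halfSpace {d : ℕ} (a : E d) (b : ℝ) : Set (E d) := {w | inner ℝ a w ≤ b}

/-- The hyperplane `⟨a, w⟩ = b` is strongly zone consistent with respect to `f` and `S`: for every
`y ∈ S` and every parallel hyperplane `⟨a, w⟩ = t` between `y` and it, the Bregman projection of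
`y` onto that parallel hyperplane lies in `S`. -/
def StronglyZoneConsistent {d : ℕ} (f : E d → ℝ) (S : Set (E d)) (a : E d) (b : ℝ) : Prop :=
  ∀ y ∈ S, ∀ t ∈ Set.uIcc (inner ℝ a y) b, ∀ p,
    IsBregmanProj f S (hyperplane a t) y p → p ∈ S

variable {d : ℕ} {ι : Type*}

/-- The feasible region: the intersection of all half-spaces `⟨a i, w⟩ ≤ b i`. -/
def feasible (a : ι → E d) (b : ι → ℝ) : Set (E d) := ⋂ i, halfSpace (a i) (b i)

/-- `x` minimizes `f` over the feasible points in the domain `closure S` of `f`. -/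
def IsOptimal (f : E d → ℝ) (S : Set (E d)) (a : ι → E d) (b : ι → ℝ) (x : E d) : Prop :=
  x ∈ feasible a b ∩ closure S ∧ ∀ y ∈ feasible a b ∩ closure S, f x ≤ f y

/-- `Q` is a deterministic separation oracle. For every input either the input is feasible (the
oracle certifies this, and the list, for instance the empty one, is unrestricted), or the list
contains a constraint that is violated by at least `φ` of the distance to the feasible region. -/
def IsSeparationOracle (a : ι → E d) (b : ι → ℝ) (Q : E d → Finset ι) : Prop :=
  ∃ φ : ℝ → ℝ, ContinuousOn φ (Set.Ici 0) ∧ MonotoneOn φ (Set.Ici 0) ∧ φ 0 = 0 ∧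
    (∀ t, 0 < t → 0 < φ t) ∧
    ∀ x, x ∈ feasible a b ∨
      ∃ i ∈ Q x, φ (Metric.infDist x (feasible a b)) ≤ Metric.infDist x (halfSpace (a i) (b i))

/-- `Q` is a random separation oracle, given by the distribution `Q x` of the list that it returns
on input `x`: on every input every constraint is returned with probability at least `τ > 0`. -/
def IsRandomSeparationOracle (Q : E d → PMF (Finset ι)) : Prop :=
  ∃ τ : ℝ, 0 < τ ∧ ∀ x i, ENNReal.ofReal τ ≤ (Q x).toOuterMeasure {T | i ∈ T}

/-- One pass through the loop of the projection phase, for the constraint `i`, from `(x, z)` to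
`(x', z')`: find `p` on the hyperplane and `θ` with `∇f p - ∇f x = θ a_i`, put `c = min (z i) θ`,
move to `x'` with `∇f x' - ∇f x = c a_i` and replace `z i` by `z i - c`. The points `p` and `x'`
are sought in `S`, where the gradient of `f` is defined. -/
def ProjStep (f : E d → ℝ) (S : Set (E d)) (a : ι → E d) (b : ι → ℝ) (i : ι)
    (x : E d) (z : ι → ℝ) (x' : E d) (z' : ι → ℝ) : Prop :=
  ∃ p ∈ S, ∃ θ : ℝ,
    p ∈ hyperplane (a i) (b i) ∧ gradient f p - gradient f x = θ • a i ∧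
    x' ∈ S ∧ gradient f x' - gradient f x = (min (z i) θ) • a i ∧
    z' i = z i - min (z i) θ ∧ ∀ j, j ≠ i → z' j = z j

/-- The data recorded along an execution of the algorithm. -/
structure Trace (d : ℕ) (ι : Type*) where
  /-- the constraints remembered at the start of iteration `ν` -/
  L : ℕ → Finset ι
  /-- the list returned by the oracle in iteration `ν` -/
  out : ℕ → Finset ι
  /-- the constraints processed in iteration `ν`, in the order in which they are processed -/
  order : ℕ → List ι
  /-- the primal vector in iteration `ν` after `k` projections -/
  x : ℕ → ℕ → E d
  /-- the dual vector in iteration `ν` after `k` projections -/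
  z : ℕ → ℕ → ι → ℝ

/-- `r` is an execution of the algorithm; which lists the oracle returns is left open here.
Each iteration goes once through the union of the remembered and the returned constraints, in any
order, and then forgets the constraints whose dual variable is zero. -/
structure IsRun (f : E d → ℝ) (S : Set (E d)) (a : ι → E d) (b : ι → ℝ) (r : Trace d ι) :
    Prop where
  init_mem : r.x 0 0 ∈ S
  init_gradient : gradient f (r.x 0 0) = 0
  init_dual : r.z 0 0 = 0
  init_list : r.L 0 = ∅
  order_nodup : ∀ ν, (r.order ν).Nodup
  mem_order : ∀ ν i, i ∈ r.order ν ↔ i ∈ r.L ν ∨ i ∈ r.out ν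
  step : ∀ ν k (hk : k < (r.order ν).length),
    ProjStep f S a b (r.order ν)[k] (r.x ν k) (r.z ν k) (r.x ν (k + 1)) (r.z ν (k + 1))
  next_x : ∀ ν, r.x (ν + 1) 0 = r.x ν (r.order ν).length
  next_z : ∀ ν, r.z (ν + 1) 0 = r.z ν (r.order ν).length
  forget : ∀ ν i, i ∈ r.L (ν + 1) ↔ i ∈ r.order ν ∧ r.z (ν + 1) 0 i ≠ 0

/-- `R` is a random execution of the algorithm with the random oracle `Q`: every outcome is an
execution, and, given the past `ℱ ν`, which determines the iterate `x^ν` that is passed to the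
oracle, the returned list has the distribution `Q (x^ν)`. -/
structure IsRandomRun (f : E d → ℝ) (S : Set (E d)) (a : ι → E d) (b : ι → ℝ)
    (Q : E d → PMF (Finset ι)) {Ω : Type*} {mΩ : MeasurableSpace Ω} (P : Measure Ω)
    (ℱ : Filtration ℕ mΩ) (R : Ω → Trace d ι) : Prop where
  isRun : ∀ ω, IsRun f S a b (R ω)
  measurable_x : ∀ ν, Measurable[ℱ ν] (fun ω => (R ω).x ν 0)
  measurable_out : ∀ ν T, MeasurableSet[ℱ (ν + 1)] {ω | (R ω).out ν = T}
  out_law : ∀ ν T,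
    P[Set.indicator {ω | (R ω).out ν = T} (fun _ => (1 : ℝ)) | ℱ ν]
      =ᵐ[P] fun ω => (Q ((R ω).x ν 0) T).toReal

/-- Inactive constraints are eventually abandoned along `r`. For every constraint `i` that is
inactive at `xstar` there is an iteration from which on its dual variable is zero after every
projection, `i` is not remembered, every step for `i` leaves the primal vector unchanged, and `i` is
not processed at all in an iteration in which the oracle returns only constraints violated at the
current iterate. Moreover, from some iteration on all remembered constraints are active. -/
def AbandonsInactive (a : ι → E d) (b : ι → ℝ) (xstar : E d) (r : Trace d ι) : Prop :=
  (∀ i, inner ℝ (a i) xstar < b i → ∃ N, ∀ ν, N ≤ ν →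
      (∀ k, k ≤ (r.order ν).length → r.z ν k i = 0) ∧
      i ∉ r.L ν ∧
      (∀ k (hk : k < (r.order ν).length), (r.order ν)[k] = i → r.x ν (k + 1) = r.x ν k) ∧
      ((∀ j ∈ r.out ν, b j < inner ℝ (a j) (r.x ν 0)) → i ∉ r.order ν)) ∧
  ∃ N, ∀ ν, N ≤ ν → ∀ i ∈ r.L ν, inner ℝ (a i) xstar = b i

end ProjectForget

namespace ProjectForget

/-! ### Bregman distances: positivity, monotone gradient, uniform closeness. -/

section Bregman

variable {d : ℕ} {f : E d → ℝ} {S : Set (E d)}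

/-! The algorithm is dual ascent. Every step preserves `z ≥ 0` and `∇f x = -∑ j, z j • a j`, so `x`
minimizes the Lagrangian for the current `z`; each step raises the Lagrangian by at least the
Bregman distance moved (`ProjStep.bregmanDist_le`). Its value is at most `f w` for every feasible
`w` in `closure S`, so the iterates stay bounded and the movement within an iteration tends to zero
(`IsRun.eventually_norm_sub_lt`). Constraints returned by the oracle are therefore asymptotically
satisfied, and either kind of oracle extends this to all constraints: the deterministic one through
`φ`, the random one through conditional Borel–Cantelli (`ae_frequently_mem_out`).

A cluster point `y` is then feasible. A constraint slack at `y` stays slack throughout late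
iterations near `y`, which forces its dual variable to zero. Complementary slackness and weak
duality give `f y ≤ f xstar`, hence `y = xstar` by strict convexity (`IsRun.tendsto_optimal`). Once
the whole sequence converges, an inactive constraint is slack in every late iteration: one iteration
clears its dual variable, and it never becomes nonzero again. -/

theorem bregmanDist_nonneg (hf : IsBregman f S) {x y : E d} (hx : x ∈ closure S) (hy : y ∈ S) :
    0 ≤ bregmanDist f x y := by
  have hgrad : HasDerivAt (fun t : ℝ => f (y + t • (x - y)))
      (inner ℝ (gradient f y) (x - y)) 0 := by
    have h := (hasGradientAt_iff_hasFDerivAt.1 (hf.differentiableAt y hy).hasGradientAt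
      ).hasLineDerivAt (x - y)
    simpa [HasLineDerivAt] using h
  have hslope := hgrad.tendsto_slope_zero_right
  have hle : inner ℝ (gradient f y) (x - y) ≤ f x - f y := by
    refine le_of_tendsto hslope ?_
    filter_upwards [Ioo_mem_nhdsGT (zero_lt_one : (0 : ℝ) < 1)] with t ht
    have hconv := hf.strictConvexOn.convexOn.2 hx (subset_closure hy) ht.1.le
      (sub_nonneg.2 ht.2.le) (by ring)
    have hpt : t • x + (1 - t) • y = y + t • (x - y) := by module
    rw [hpt] at hconv
    simp only [zero_add, zero_smul, add_zero, smul_eq_mul] at hconv ⊢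
    rw [inv_mul_le_iff₀ ht.1]
    linarith
  unfold bregmanDist
  linarith

/-- At the midpoint, strict convexity bounds `f` strictly from above and the tangent at `y` bounds
it from below. -/
theorem bregmanDist_pos (hf : IsBregman f S) {x y : E d} (hx : x ∈ closure S) (hy : y ∈ S)
    (hxy : x ≠ y) : 0 < bregmanDist f x y := by
  have hconv := hf.strictConvexOn.2 hx (subset_closure hy) hxy
    (show (0 : ℝ) < 1 / 2 by norm_num) (show (0 : ℝ) < 1 / 2 by norm_num) (by norm_num)
  have hmem := hf.strictConvexOn.1 hx (subset_closure hy)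
    (show (0 : ℝ) ≤ 1 / 2 by norm_num) (show (0 : ℝ) ≤ 1 / 2 by norm_num) (by norm_num)
  have hnonneg := bregmanDist_nonneg hf hmem hy
  have hpt : (1 / 2 : ℝ) • x + (1 / 2 : ℝ) • y - y = (1 / 2 : ℝ) • (x - y) := by module
  unfold bregmanDist at hnonneg ⊢
  rw [hpt, inner_smul_right] at hnonneg
  simp only [smul_eq_mul] at hconv
  linarith

theorem inner_gradient_sub_pos (hf : IsBregman f S) {x y : E d} (hx : x ∈ S) (hy : y ∈ S)
    (hxy : x ≠ y) : 0 < inner ℝ (gradient f x - gradient f y) (x - y) := by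
  have h1 := bregmanDist_pos hf (subset_closure hx) hy hxy
  have h2 := bregmanDist_pos hf (subset_closure hy) hx hxy.symm
  unfold bregmanDist at h1 h2
  rw [← neg_sub x y, inner_neg_right] at h2
  rw [inner_sub_left]
  linarith

theorem gradient_injOn (hf : IsBregman f S) : Set.InjOn (gradient f) S := by
  intro x hx y hy h
  by_contra hne
  have := inner_gradient_sub_pos hf hx hy hne
  simp [h] at this

/-- On bounded subsets of the zone, points at small Bregman distance are uniformly close. -/
theorem exists_bregmanDist_modulus (hf : IsBregman f S) {B : Set (E d)}
    (hB : Bornology.IsBounded B) (hBS : B ⊆ S) {δ : ℝ} (hδ : 0 < δ) :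
    ∃ η > 0, ∀ u ∈ B, ∀ v ∈ B, bregmanDist f u v < η → ‖u - v‖ < δ := by
  by_contra! hcon
  choose u hu v hv hD hδ' using fun n : ℕ => hcon (1 / ((n : ℝ) + 1)) (by positivity)
  -- Along a subsequence `v` converges; axiom (3) of a Bregman function drags `u` to the same limit.
  obtain ⟨w, -, φ, hφ, hw⟩ := tendsto_subseq_of_bounded hB hv
  have hDlim : Tendsto (fun n => bregmanDist f (u (φ n)) (v (φ n))) atTop (𝓝 0) :=
    squeeze_zero (fun n => bregmanDist_nonneg hf (subset_closure (hBS (hu _))) (hBS (hv _)))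
      (fun n => (hD (φ n)).le) (tendsto_one_div_add_atTop_nhds_zero_nat.comp hφ.tendsto_atTop)
  have hulim := hf.tendsto_of_dist (fun n => u (φ n)) (fun n => v (φ n)) w
    (fun n => subset_closure (hBS (hu _))) (fun n => hBS (hv _)) hDlim hw
    (hB.subset (by rintro _ ⟨n, rfl⟩; exact hu _))
  have hzero : Tendsto (fun n => ‖u (φ n) - v (φ n)‖) atTop (𝓝 0) := by
    simpa using (hulim.sub hw).norm
  obtain ⟨n, hn⟩ := (hzero.eventually_lt_const hδ).exists
  exact (hn.trans_le (hδ' (φ n))).false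

end Bregman

/-! ### A single projection step and its effect on the Lagrangian. -/

section ProjectionStep

variable {d : ℕ} {ι : Type*} {f : E d → ℝ} {S : Set (E d)} {a : ι → E d} {b : ι → ℝ} {i : ι}
  {x x' : E d} {z z' : ι → ℝ}

namespace ProjStep

theorem mem (h : ProjStep f S a b i x z x' z') : x' ∈ S := by
  obtain ⟨p, -, θ, -, -, hx', -⟩ := h
  exact hx'

theorem dual_of_ne (h : ProjStep f S a b i x z x' z') {j : ι} (hj : j ≠ i) : z' j = z j := by
  obtain ⟨p, -, θ, -, -, -, -, -, hz⟩ := h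
  exact hz j hj

theorem dual_nonneg (h : ProjStep f S a b i x z x' z') (hz : ∀ j, 0 ≤ z j) (j : ι) :
    0 ≤ z' j := by
  obtain ⟨p, -, θ, -, -, -, -, hi, hne⟩ := h
  by_cases hj : j = i
  · subst hj
    rw [hi]
    exact sub_nonneg.2 (min_le_left _ _)
  · rw [hne j hj]
    exact hz j

/-- A violated constraint is projected onto its bounding hyperplane. -/
theorem inner_eq_of_violated (hf : IsBregman f S) (h : ProjStep f S a b i x z x' z')
    (hx : x ∈ S) (hz : 0 ≤ z i) (hviol : b i < inner ℝ (a i) x) : inner ℝ (a i) x' = b i := by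
  obtain ⟨p, hp, θ, hpb, hpθ, hx', hxc, -, -⟩ := h
  have hpb' : inner ℝ (a i) p = b i := hpb
  have hne : p ≠ x := by
    rintro rfl
    linarith
  have hpos := inner_gradient_sub_pos hf hp hx hne
  rw [hpθ, real_inner_smul_left, inner_sub_right, hpb'] at hpos
  -- Monotonicity of the gradient gives `θ * (b i - ⟨a i, x⟩) > 0`, which fixes the sign of `θ`.
  -- Then the minimum is `θ`, and injectivity of the gradient yields `x' = p`.
  have hθ : θ < 0 := by
    by_contra! hθ
    nlinarith
  rw [min_eq_right (hθ.le.trans hz), ← hpθ] at hxc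
  rw [gradient_injOn hf hx' hp (sub_left_injective hxc), hpb']

/-- A slack constraint either loses its dual variable or is projected onto its bounding
hyperplane. -/
theorem dual_eq_zero_or_inner_eq_of_slack (hf : IsBregman f S)
    (h : ProjStep f S a b i x z x' z') : z' i = 0 ∨ inner ℝ (a i) x' = b i := by
  obtain ⟨p, hp, θ, hpb, hpθ, hx', hxc, hzi, -⟩ := h
  rcases le_total (z i) θ with hle | hle
  · left
    rw [hzi, min_eq_left hle, sub_self]
  · right
    rw [min_eq_right hle, ← hpθ] at hxc
    rw [gradient_injOn hf hx' hp (sub_left_injective hxc)]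
    exact hpb

/-- A step for a slack constraint with vanishing dual variable does not move. -/
theorem eq_of_slack (hf : IsBregman f S) (h : ProjStep f S a b i x z x' z')
    (hx : x ∈ S) (hz : z i = 0) (hslack : inner ℝ (a i) x < b i) : x' = x := by
  obtain ⟨p, hp, θ, hpb, hpθ, hx', hxc, -, -⟩ := h
  have hpb' : inner ℝ (a i) p = b i := hpb
  have hne : p ≠ x := by
    rintro rfl
    linarith
  have hpos := inner_gradient_sub_pos hf hp hx hne
  rw [hpθ, real_inner_smul_left, inner_sub_right, hpb'] at hpos
  have hθ : 0 ≤ θ := by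
    by_contra! hθ
    nlinarith
  rw [hz, min_eq_left hθ, zero_smul, sub_eq_zero] at hxc
  exact gradient_injOn hf hx' hx hxc

end ProjStep

/-- The Lagrangian of the problem of minimizing `f` over the feasible region. -/
noncomputable def lagrangian [Fintype ι] (f : E d → ℝ) (a : ι → E d) (b : ι → ℝ)
    (x : E d) (z : ι → ℝ) : ℝ :=
  f x + ∑ j, z j * (inner ℝ (a j) x - b j)

variable [Fintype ι]

theorem sum_smul_of_eq_off {V : Type*} [AddCommGroup V] [Module ℝ V] {c : ℝ}
    (hi : z' i = z i - c) (hne : ∀ j, j ≠ i → z' j = z j) (v : ι → V) :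
    ∑ j, z' j • v j = ∑ j, z j • v j - c • v i := by
  classical
  rw [← Finset.add_sum_erase _ _ (Finset.mem_univ i),
    ← Finset.add_sum_erase _ (fun j => z j • v j) (Finset.mem_univ i), hi,
    Finset.sum_congr rfl fun j hj => by rw [hne j (Finset.ne_of_mem_erase hj)]]
  module

theorem ProjStep.gradient_eq (h : ProjStep f S a b i x z x' z')
    (hgrad : gradient f x = -∑ j, z j • a j) : gradient f x' = -∑ j, z' j • a j := by
  obtain ⟨p, -, θ, -, -, -, hxc, hzi, hne⟩ := h
  rw [sum_smul_of_eq_off hzi hne, neg_sub, ← hxc, hgrad]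
  abel

/-- The Lagrangian differs from `f` by an affine function and is stationary at `x`, so its excess at
`w` over its value at `x` is exactly the Bregman distance. -/
theorem lagrangian_eq_sub (hgrad : gradient f x = -∑ j, z j • a j) (w : E d) :
    lagrangian f a b x z =
      f w - bregmanDist f w x - ∑ j, z j * (b j - inner ℝ (a j) w) := by
  have hsum : inner ℝ (gradient f x) (w - x) =
      -∑ j, z j * (inner ℝ (a j) w - inner ℝ (a j) x) := by
    rw [hgrad, inner_neg_left, sum_inner]
    simp only [real_inner_smul_left, ← mul_sub, inner_sub_right]
  have hsplit : ∑ j, z j * (inner ℝ (a j) x - b j) + ∑ j, z j * (b j - inner ℝ (a j) w) =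
      -∑ j, z j * (inner ℝ (a j) w - inner ℝ (a j) x) := by
    rw [← Finset.sum_add_distrib, ← Finset.sum_neg_distrib]
    exact Finset.sum_congr rfl fun j _ => by ring
  unfold lagrangian bregmanDist
  linarith

/-- A projection step increases the Lagrangian by at least the Bregman distance moved. -/
theorem ProjStep.bregmanDist_le (hf : IsBregman f S) (h : ProjStep f S a b i x z x' z')
    (hz : 0 ≤ z i) (hgrad : gradient f x = -∑ j, z j • a j) :
    bregmanDist f x' x ≤ lagrangian f a b x' z' - lagrangian f a b x z := by
  obtain ⟨p, hp, θ, hpb, hpθ, hx', hxc, hzi, hne⟩ := h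
  have hpb' : inner ℝ (a i) p = b i := hpb
  set c := min (z i) θ with hc
  have hsum : ∑ j, z' j * (inner ℝ (a j) x' - b j) =
      ∑ j, z j * (inner ℝ (a j) x' - b j) - c * (inner ℝ (a i) x' - b i) :=
    sum_smul_of_eq_off hzi hne _
  -- The gain in the Lagrangian is `bregmanDist f x' x` plus this term. It vanishes if the step
  -- reaches `p`; otherwise `c = z i ≥ 0` and `x'` is strictly slack.
  have hslack : 0 ≤ c * (b i - inner ℝ (a i) x') := by
    have hpx : gradient f p - gradient f x' = (θ - c) • a i := by
      rw [sub_smul, ← hpθ, ← hxc]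
      abel
    by_cases hpe : p = x'
    · rw [← hpe, hpb', sub_self, mul_zero]
    · have hpos := inner_gradient_sub_pos hf hp hx' hpe
      rw [hpx, real_inner_smul_left, inner_sub_right, hpb'] at hpos
      rcases le_total (z i) θ with hle | hle
      · rw [hc, min_eq_left hle] at hpos ⊢
        refine mul_nonneg hz ?_
        by_contra! hneg
        nlinarith
      · rw [hc, min_eq_right hle] at hpos
        simp at hpos
  have hlag := lagrangian_eq_sub (b := b) hgrad x'
  have hneg : ∑ j, z j * (inner ℝ (a j) x' - b j) = -∑ j, z j * (b j - inner ℝ (a j) x') := by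
    rw [← Finset.sum_neg_distrib]
    exact Finset.sum_congr rfl fun j _ => by ring
  unfold lagrangian at hlag ⊢
  linarith

end ProjectionStep

end ProjectForget

namespace ProjectForget

/-! ### Executions: invariants and the evolution of dual variables. -/

section Run

variable {d : ℕ} {ι : Type*} {f : E d → ℝ} {S : Set (E d)} {a : ι → E d} {b : ι → ℝ}
  {r : Trace d ι} {xstar : E d}

namespace IsRun

/-- A property of the primal-dual pair that holds initially and is preserved by projection steps
holds throughout the run. -/
theorem invariant (h : IsRun f S a b r) {p : E d → (ι → ℝ) → Prop} (hinit : p (r.x 0 0) (r.z 0 0))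
    (hstep : ∀ i x z x' z', ProjStep f S a b i x z x' z' → p x z → p x' z') :
    ∀ ν k, k ≤ (r.order ν).length → p (r.x ν k) (r.z ν k) := by
  have hinner : ∀ ν, p (r.x ν 0) (r.z ν 0) →
      ∀ k, k ≤ (r.order ν).length → p (r.x ν k) (r.z ν k) := by
    intro ν h0 k
    induction k with
    | zero => exact fun _ => h0
    | succ k ih => exact fun hk => hstep _ _ _ _ _ (h.step ν k hk) (ih (Nat.le_of_succ_le hk))
  have houter : ∀ ν, p (r.x ν 0) (r.z ν 0) := by
    intro ν
    induction ν with
    | zero => exact hinit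
    | succ ν ih =>
      rw [h.next_x, h.next_z]
      exact hinner ν ih _ le_rfl
  exact fun ν => hinner ν (houter ν)

theorem mem_zone (h : IsRun f S a b r) {ν k : ℕ} (hk : k ≤ (r.order ν).length) :
    r.x ν k ∈ S :=
  h.invariant (p := fun x _ => x ∈ S) h.init_mem (fun _ _ _ _ _ hs _ => hs.mem) ν k hk

theorem dual_nonneg (h : IsRun f S a b r) {ν k : ℕ} (hk : k ≤ (r.order ν).length) (i : ι) :
    0 ≤ r.z ν k i :=
  h.invariant (p := fun _ z => ∀ i, 0 ≤ z i) (fun i => by rw [h.init_dual]; exact le_rfl)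
    (fun _ _ _ _ _ hs hz => hs.dual_nonneg hz) ν k hk i

/-- A dual variable changes only when its constraint is processed, and only constraints with zero
dual variable are forgotten. -/
theorem mem_list_of_dual_ne_zero (h : IsRun f S a b r) {ν : ℕ} {i : ι} (hz : r.z ν 0 i ≠ 0) :
    i ∈ r.L ν := by
  induction ν with
  | zero => simp [h.init_dual] at hz
  | succ ν ih =>
    rw [h.forget]
    refine ⟨?_, hz⟩
    by_contra hi
    have hconst : ∀ k, k ≤ (r.order ν).length → r.z ν k i = r.z ν 0 i := by
      intro k
      induction k with
      | zero => exact fun _ => rfl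
      | succ k ihk =>
        intro hk
        rw [(h.step ν k hk).dual_of_ne, ihk (Nat.le_of_succ_le hk)]
        rintro rfl
        exact hi (List.getElem_mem _)
    rw [h.next_z, hconst _ le_rfl] at hz
    exact hi ((h.mem_order ν i).2 (Or.inl (ih hz)))

/-- After an iteration in which constraint `i` stays slack its dual variable is zero. -/
theorem dual_eq_zero_of_slack (hf : IsBregman f S) (h : IsRun f S a b r) {ν : ℕ} {i : ι}
    (hslack : ∀ k, k ≤ (r.order ν).length → inner ℝ (a i) (r.x ν k) < b i) :
    r.z (ν + 1) 0 i = 0 := by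
  have hclaim : ∀ k, k ≤ (r.order ν).length →
      r.z ν k i = 0 ∨ i ∈ (r.order ν).drop k := by
    intro k
    induction k with
    | zero =>
      intro _
      by_cases hz : r.z ν 0 i = 0
      · exact Or.inl hz
      · exact Or.inr (by simpa using (h.mem_order ν i).2 (Or.inl (h.mem_list_of_dual_ne_zero hz)))
    | succ k ih =>
      intro hk
      have hs := h.step ν k hk
      by_cases hi : (r.order ν)[k] = i
      · rw [hi] at hs
        exact Or.inl ((hs.dual_eq_zero_or_inner_eq_of_slack hf).resolve_right (hslack _ hk).ne)
      · rw [hs.dual_of_ne (Ne.symm hi)]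
        refine (ih (Nat.le_of_succ_le hk)).imp_right fun hmem => ?_
        rw [List.drop_eq_getElem_cons hk] at hmem
        exact (List.mem_cons.1 hmem).resolve_left (Ne.symm hi)
  rw [h.next_z]
  simpa using hclaim _ le_rfl

/-- A vanishing dual variable stays zero while its constraint stays slack. -/
theorem dual_eq_zero_of_slack_of_init (hf : IsBregman f S) (h : IsRun f S a b r) {ν : ℕ} {i : ι}
    (hslack : ∀ k, k ≤ (r.order ν).length → inner ℝ (a i) (r.x ν k) < b i)
    (hz : r.z ν 0 i = 0) : ∀ k, k ≤ (r.order ν).length → r.z ν k i = 0 := by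
  intro k
  induction k with
  | zero => exact fun _ => hz
  | succ k ih =>
    intro hk
    have hs := h.step ν k hk
    by_cases hi : (r.order ν)[k] = i
    · rw [hi] at hs
      exact (hs.dual_eq_zero_or_inner_eq_of_slack hf).resolve_right (hslack _ hk).ne
    · rw [hs.dual_of_ne (Ne.symm hi), ih (Nat.le_of_succ_le hk)]

/-! ### Dual ascent, vanishing movement and convergence to the optimum. -/

variable [Fintype ι]

theorem gradient_eq (h : IsRun f S a b r) {ν k : ℕ} (hk : k ≤ (r.order ν).length) :
    gradient f (r.x ν k) = -∑ j, r.z ν k j • a j :=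
  h.invariant (p := fun x z => gradient f x = -∑ j, z j • a j)
    (by simp [h.init_gradient, h.init_dual]) (fun _ _ _ _ _ hs hg => hs.gradient_eq hg) ν k hk

theorem bregmanDist_step_le (hf : IsBregman f S) (h : IsRun f S a b r) {ν k : ℕ}
    (hk : k < (r.order ν).length) :
    bregmanDist f (r.x ν (k + 1)) (r.x ν k) ≤
      lagrangian f a b (r.x ν (k + 1)) (r.z ν (k + 1)) - lagrangian f a b (r.x ν k) (r.z ν k) :=
  (h.step ν k hk).bregmanDist_le hf (h.dual_nonneg hk.le _) (h.gradient_eq hk.le)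

theorem lagrangian_le_lagrangian (hf : IsBregman f S) (h : IsRun f S a b r) {ν k l : ℕ}
    (hkl : k ≤ l) (hl : l ≤ (r.order ν).length) :
    lagrangian f a b (r.x ν k) (r.z ν k) ≤ lagrangian f a b (r.x ν l) (r.z ν l) := by
  induction l, hkl using Nat.le_induction with
  | base => exact le_rfl
  | succ l hkl ih =>
    have hD := bregmanDist_nonneg hf (subset_closure (h.mem_zone hl))
      (h.mem_zone (Nat.le_of_succ_le hl))
    linarith [ih (Nat.le_of_succ_le hl), h.bregmanDist_step_le hf hl]

theorem lagrangian_monotone (hf : IsBregman f S) (h : IsRun f S a b r) :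
    Monotone fun ν => lagrangian f a b (r.x ν 0) (r.z ν 0) := by
  refine monotone_nat_of_le_succ fun ν => ?_
  rw [h.next_x, h.next_z]
  exact h.lagrangian_le_lagrangian hf (Nat.zero_le _) le_rfl

/-- Weak duality with its gap: the term dropped from `lagrangian_eq_sub` is nonnegative by
feasibility of `w` and `z ≥ 0`. -/
theorem bregmanDist_le (h : IsRun f S a b r) {w : E d}
    (hw : w ∈ feasible a b) {ν k : ℕ} (hk : k ≤ (r.order ν).length) :
    bregmanDist f w (r.x ν k) ≤ f w - lagrangian f a b (r.x ν k) (r.z ν k) := by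
  have hlag := lagrangian_eq_sub (b := b) (h.gradient_eq hk) w
  have hsum : 0 ≤ ∑ j, r.z ν k j * (b j - inner ℝ (a j) w) :=
    Finset.sum_nonneg fun j _ =>
      mul_nonneg (h.dual_nonneg hk j) (sub_nonneg.2 (Set.mem_iInter.1 hw j))
  linarith

theorem isBounded (hf : IsBregman f S) (h : IsRun f S a b r) {w : E d}
    (hw : w ∈ feasible a b) (hwS : w ∈ closure S) :
    Bornology.IsBounded {y | ∃ ν k, k ≤ (r.order ν).length ∧ r.x ν k = y} := by
  refine (hf.bounded_right w hwS (f w - lagrangian f a b (r.x 0 0) (r.z 0 0))).subset ?_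
  rintro _ ⟨ν, k, hk, rfl⟩
  refine ⟨h.mem_zone hk, (h.bregmanDist_le hw hk).trans ?_⟩
  have h1 := h.lagrangian_monotone hf (Nat.zero_le ν)
  have h2 := h.lagrangian_le_lagrangian hf (Nat.zero_le k) hk
  simp only at h1
  linarith

theorem lagrangian_le (hf : IsBregman f S) (h : IsRun f S a b r) {w : E d}
    (hw : w ∈ feasible a b) (hwS : w ∈ closure S) (ν : ℕ) :
    lagrangian f a b (r.x ν 0) (r.z ν 0) ≤ f w := by
  have h1 := h.bregmanDist_le hw (Nat.zero_le (r.order ν).length)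
  have h2 := bregmanDist_nonneg hf hwS (h.mem_zone (Nat.zero_le (r.order ν).length))
  linarith

/-- The individual projection steps become arbitrarily short. -/
theorem eventually_norm_step_lt (hf : IsBregman f S) (h : IsRun f S a b r) {w : E d}
    (hw : w ∈ feasible a b) (hwS : w ∈ closure S) {δ : ℝ} (hδ : 0 < δ) :
    ∀ᶠ ν in atTop, ∀ k, k < (r.order ν).length → ‖r.x ν (k + 1) - r.x ν k‖ < δ := by
  obtain ⟨η, hη, hmod⟩ := exists_bregmanDist_modulus hf (h.isBounded hf hw hwS)
    (by rintro _ ⟨ν, k, hk, rfl⟩; exact h.mem_zone hk) hδ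
  -- The Lagrangian is monotone and bounded, so its gain per iteration tends to zero; each step's
  -- gain is at most that of its iteration.
  have hconv := tendsto_atTop_ciSup (h.lagrangian_monotone hf)
    ⟨f w, by rintro _ ⟨ν, rfl⟩; exact h.lagrangian_le hf hw hwS ν⟩
  have hdiff := (hconv.comp (tendsto_add_atTop_nat 1)).sub hconv
  rw [sub_self] at hdiff
  filter_upwards [hdiff.eventually_lt_const hη] with ν hν k hk
  refine hmod _ ⟨ν, k + 1, hk, rfl⟩ _ ⟨ν, k, hk.le, rfl⟩ ?_
  simp only [Function.comp_apply] at hν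
  rw [h.next_x, h.next_z] at hν
  linarith [h.bregmanDist_step_le hf hk, h.lagrangian_le_lagrangian hf (Nat.zero_le k) hk.le,
    h.lagrangian_le_lagrangian hf (Nat.succ_le_of_lt hk) le_rfl]

/-- The distance moved within one iteration becomes arbitrarily small. -/
theorem eventually_norm_sub_lt (hf : IsBregman f S) (h : IsRun f S a b r) {w : E d}
    (hw : w ∈ feasible a b) (hwS : w ∈ closure S) {δ : ℝ} (hδ : 0 < δ) :
    ∀ᶠ ν in atTop, ∀ k, k ≤ (r.order ν).length → ‖r.x ν k - r.x ν 0‖ < δ := by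
  have hc : (0 : ℝ) < Fintype.card ι + 1 := by positivity
  -- An iteration has at most `Fintype.card ι` steps, since no constraint is repeated.
  filter_upwards [h.eventually_norm_step_lt hf hw hwS (div_pos hδ hc)] with ν hν k hk
  have hsum : ∀ k, k ≤ (r.order ν).length →
      ‖r.x ν k - r.x ν 0‖ ≤ k * (δ / (Fintype.card ι + 1)) := by
    intro k
    induction k with
    | zero => simp
    | succ k ih =>
      intro hk
      have htri := norm_sub_le_norm_sub_add_norm_sub (r.x ν (k + 1)) (r.x ν k) (r.x ν 0)
      push_cast
      linarith [ih (Nat.le_of_succ_le hk), hν k hk]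
  have hkc : (k : ℝ) < Fintype.card ι + 1 := by
    exact_mod_cast Nat.lt_succ_of_le (hk.trans (h.order_nodup ν).length_le_card)
  calc ‖r.x ν k - r.x ν 0‖ ≤ k * (δ / (Fintype.card ι + 1)) := hsum k hk
    _ < (Fintype.card ι + 1) * (δ / (Fintype.card ι + 1)) := by gcongr
    _ = δ := mul_div_cancel₀ _ hc.ne'

theorem eventually_abs_inner_sub_lt (hf : IsBregman f S) (h : IsRun f S a b r) {w : E d}
    (hw : w ∈ feasible a b) (hwS : w ∈ closure S) (i : ι) {ε : ℝ} (hε : 0 < ε) :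
    ∀ᶠ ν in atTop, ∀ k, k ≤ (r.order ν).length →
      |inner ℝ (a i) (r.x ν k) - inner ℝ (a i) (r.x ν 0)| < ε := by
  have hc : 0 < ‖a i‖ + 1 := by positivity
  filter_upwards [h.eventually_norm_sub_lt hf hw hwS (div_pos hε hc)] with ν hν k hk
  rw [← inner_sub_right]
  calc |inner ℝ (a i) (r.x ν k - r.x ν 0)| ≤ ‖a i‖ * ‖r.x ν k - r.x ν 0‖ :=
        abs_real_inner_le_norm _ _
    _ ≤ (‖a i‖ + 1) * ‖r.x ν k - r.x ν 0‖ := by gcongr; linarith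
    _ < (‖a i‖ + 1) * (ε / (‖a i‖ + 1)) := by gcongr; exact hν k hk
    _ = ε := mul_div_cancel₀ _ hc.ne'

/-- The constraints returned by the oracle are asymptotically satisfied. -/
theorem eventually_inner_lt_of_mem_out (hf : IsBregman f S) (h : IsRun f S a b r) {w : E d}
    (hw : w ∈ feasible a b) (hwS : w ∈ closure S) (i : ι) {ε : ℝ} (hε : 0 < ε) :
    ∀ᶠ ν in atTop, i ∈ r.out ν → inner ℝ (a i) (r.x ν 0) < b i + ε := by
  filter_upwards [h.eventually_abs_inner_sub_lt hf hw hwS i hε] with ν hν hi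
  obtain ⟨k, hk, rfl⟩ := List.mem_iff_getElem.1 ((h.mem_order ν i).2 (Or.inr hi))
  -- A violation by `ε` at the start survives until `i` is processed, and the projection onto the
  -- hyperplane would then leave a total change of at least `ε`.
  by_contra! hcon
  have h1 := abs_lt.1 (hν k hk.le)
  have h2 := abs_lt.1 (hν (k + 1) hk)
  have h3 := (h.step ν k hk).inner_eq_of_violated hf (h.mem_zone hk.le) (h.dual_nonneg hk.le _)
    (by linarith)
  linarith

/-- If all constraints are asymptotically satisfied, then the iterates converge to the optimum. -/
theorem tendsto_optimal (hf : IsBregman f S) (h : IsRun f S a b r)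
    (hopt : IsOptimal f S a b xstar)
    (hfeas : ∀ i, ∀ ε > 0, ∀ᶠ ν in atTop, inner ℝ (a i) (r.x ν 0) < b i + ε) :
    Tendsto (fun ν => r.x ν 0) atTop (𝓝 xstar) := by
  obtain ⟨⟨hw, hwS⟩, hmin⟩ := hopt
  have hzone : ∀ ν, r.x ν 0 ∈ S := fun ν => h.mem_zone (Nat.zero_le _)
  refine tendsto_of_subseq_tendsto fun ns hns => ?_
  obtain ⟨y, -, φ, hφ, hy⟩ := tendsto_subseq_of_bounded
    (x := fun n => r.x (ns n) 0) (h.isBounded hf hw hwS) fun n => ⟨_, 0, Nat.zero_le _, rfl⟩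
  refine ⟨φ, ?_⟩
  have hm : Tendsto (fun n => ns (φ n)) atTop atTop := hns.comp hφ.tendsto_atTop
  have hinner : ∀ i, Tendsto (fun n => inner ℝ (a i) (r.x (ns (φ n)) 0)) atTop
      (𝓝 (inner ℝ (a i) y)) := fun i => tendsto_const_nhds.inner hy
  have hyS : y ∈ closure S :=
    mem_closure_of_tendsto hy (Eventually.of_forall fun n => hzone _)
  have hyfeas : y ∈ feasible a b := Set.mem_iInter.2 fun i => le_of_forall_pos_le_add fun ε hε =>
    le_of_tendsto (hinner i) ((hm.eventually (hfeas i ε hε)).mono fun _ hn => hn.le)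
  -- The shift by one matters: dual variables of constraints slack at `y` are known to vanish only
  -- at the end of the iteration.
  have hy' : Tendsto (fun n => r.x (ns (φ n) + 1) 0) atTop (𝓝 y) := by
    rw [Metric.tendsto_nhds]
    intro ε hε
    filter_upwards [Metric.tendsto_nhds.1 hy (ε / 2) (half_pos hε),
      hm.eventually (h.eventually_norm_sub_lt hf hw hwS (half_pos hε))] with n h1 h2
    rw [h.next_x]
    have h3 := h2 _ le_rfl
    rw [← dist_eq_norm] at h3
    simp only [Function.comp_apply] at h1
    linarith [dist_triangle (r.x (ns (φ n)) (r.order (ns (φ n))).length) (r.x (ns (φ n)) 0) y]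
  have hslack : ∀ᶠ n in atTop, ∀ i, inner ℝ (a i) y < b i → r.z (ns (φ n) + 1) 0 i = 0 := by
    refine eventually_all.2 fun i => ?_
    by_cases hi : inner ℝ (a i) y < b i
    · have hε : 0 < (b i - inner ℝ (a i) y) / 2 := by linarith
      filter_upwards [hm.eventually (h.eventually_abs_inner_sub_lt hf hw hwS i hε),
        (hinner i).eventually_lt_const
          (show inner ℝ (a i) y < (inner ℝ (a i) y + b i) / 2 by linarith)] with n h1 h2 _
      refine h.dual_eq_zero_of_slack hf fun k hk => ?_
      linarith [abs_lt.1 (h1 k hk)]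
    · exact Eventually.of_forall fun n hi' => absurd hi' hi
  have hD := hf.dist_tendsto (fun n => r.x (ns (φ n) + 1) 0) y (fun n => hzone _) hy'
  -- By complementary slackness the Lagrangian equals `f y` minus a Bregman distance tending to
  -- zero, and weak duality bounds it by `f xstar`.
  have hle : f y ≤ f xstar := by
    have hlim : Tendsto (fun n => f y - bregmanDist f y (r.x (ns (φ n) + 1) 0)) atTop
        (𝓝 (f y)) := by simpa using hD.const_sub (f y)
    refine le_of_tendsto hlim ?_
    filter_upwards [hslack] with n hn
    have hlag := lagrangian_eq_sub (b := b) (h.gradient_eq (Nat.zero_le _ :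
      0 ≤ (r.order (ns (φ n) + 1)).length)) y
    have hsum : ∑ j, r.z (ns (φ n) + 1) 0 j * (b j - inner ℝ (a j) y) = 0 :=
      Finset.sum_eq_zero fun j _ => by
        have hj : inner ℝ (a j) y ≤ b j := Set.mem_iInter.1 hyfeas j
        rcases hj.lt_or_eq with hj | hj
        · rw [hn j hj, zero_mul]
        · rw [hj, sub_self, mul_zero]
    linarith [h.lagrangian_le hf hw hwS (ns (φ n) + 1)]
  have hconv : Convex ℝ (feasible a b ∩ closure S) :=
    (convex_iInter fun i => convex_halfSpace_le (innerSL ℝ (a i)).isLinear (b i)).inter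
      hf.zone_convex.closure
  have hyx : y = xstar :=
    (hf.strictConvexOn.subset Set.inter_subset_right hconv).eq_of_isMinOn
      (fun v hv => hle.trans (hmin v hv)) hmin ⟨hyfeas, hyS⟩ ⟨hw, hwS⟩
  exact hyx ▸ hy

/-- If all constraints are asymptotically satisfied, then inactive constraints are abandoned. -/
theorem abandonsInactive (hf : IsBregman f S) (h : IsRun f S a b r)
    (hopt : IsOptimal f S a b xstar)
    (hfeas : ∀ i, ∀ ε > 0, ∀ᶠ ν in atTop, inner ℝ (a i) (r.x ν 0) < b i + ε) :
    AbandonsInactive a b xstar r := by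
  have hlim := h.tendsto_optimal hf hopt hfeas
  obtain ⟨⟨hw, hwS⟩, -⟩ := hopt
  have hfst : ∀ i, inner ℝ (a i) xstar < b i → ∃ N, ∀ ν, N ≤ ν →
      (∀ k, k ≤ (r.order ν).length → r.z ν k i = 0) ∧
      i ∉ r.L ν ∧
      (∀ k (hk : k < (r.order ν).length), (r.order ν)[k] = i → r.x ν (k + 1) = r.x ν k) ∧
      ((∀ j ∈ r.out ν, b j < inner ℝ (a j) (r.x ν 0)) → i ∉ r.order ν) := by
    intro i hi
    have hε : 0 < (b i - inner ℝ (a i) xstar) / 2 := by linarith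
    have hinner : Tendsto (fun ν => inner ℝ (a i) (r.x ν 0)) atTop (𝓝 (inner ℝ (a i) xstar)) :=
      tendsto_const_nhds.inner hlim
    have hslack : ∀ᶠ ν in atTop, ∀ k, k ≤ (r.order ν).length →
        inner ℝ (a i) (r.x ν k) < b i := by
      filter_upwards [h.eventually_abs_inner_sub_lt hf hw hwS i hε, hinner.eventually_lt_const
        (show inner ℝ (a i) xstar < (inner ℝ (a i) xstar + b i) / 2 by linarith)]
        with ν h1 h2 k hk
      linarith [abs_lt.1 (h1 k hk)]
    obtain ⟨N, hN⟩ := eventually_atTop.1 hslack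
    -- Iteration `N`, the first known to be slack throughout, is spent clearing the dual variable.
    refine ⟨N + 1, fun ν hν => ?_⟩
    obtain ⟨μ, rfl⟩ : ∃ μ, ν = μ + 1 := ⟨ν - 1, by omega⟩
    have hz0 := h.dual_eq_zero_of_slack hf (hN μ (by omega))
    have hs := hN (μ + 1) (by omega)
    have hz := h.dual_eq_zero_of_slack_of_init hf hs hz0
    have hL : i ∉ r.L (μ + 1) := fun hmem => ((h.forget μ i).1 hmem).2 hz0
    refine ⟨hz, hL, fun k hk hki => ?_, fun hout hmem => ?_⟩
    · have hstep := h.step (μ + 1) k hk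
      rw [hki] at hstep
      exact hstep.eq_of_slack hf (h.mem_zone hk.le) (hz k hk.le) (hs k hk.le)
    · exact (hout i (((h.mem_order _ i).1 hmem).resolve_left hL)).not_gt (hs 0 (Nat.zero_le _))
  refine ⟨hfst, ?_⟩
  have hall : ∀ᶠ ν in atTop, ∀ i, i ∈ r.L ν → inner ℝ (a i) xstar = b i := by
    refine eventually_all.2 fun i => ?_
    have hle : inner ℝ (a i) xstar ≤ b i := Set.mem_iInter.1 hw i
    rcases hle.lt_or_eq with hlt | heq
    · obtain ⟨N, hN⟩ := hfst i hlt
      exact eventually_atTop.2 ⟨N, fun ν hν hmem => absurd hmem (hN ν hν).2.1⟩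
    · exact Eventually.of_forall fun _ _ => heq
  exact eventually_atTop.1 hall

end IsRun

end Run

/-! ### Constraint violation versus distance. -/

section HalfSpace

variable {d : ℕ} {a : E d} {b : ℝ} {x : E d}

theorem mul_infDist_halfSpace_le (ha : a ≠ 0) (hx : b ≤ inner ℝ a x) :
    ‖a‖ * Metric.infDist x (halfSpace a b) ≤ inner ℝ a x - b := by
  have hna : 0 < ‖a‖ := norm_pos_iff.2 ha
  set t := (inner ℝ a x - b) / ‖a‖ ^ 2 with ht
  have ht0 : 0 ≤ t := div_nonneg (sub_nonneg.2 hx) (sq_nonneg _)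
  have htm : t * ‖a‖ ^ 2 = inner ℝ a x - b := div_mul_cancel₀ _ (by positivity)
  have hmem : x - t • a ∈ halfSpace a b := by
    change inner ℝ a (x - t • a) ≤ b
    rw [inner_sub_right, inner_smul_right, real_inner_self_eq_norm_sq, htm]
    linarith
  have hdist : dist x (x - t • a) = t * ‖a‖ := by
    rw [dist_eq_norm, sub_sub_cancel, norm_smul, Real.norm_of_nonneg ht0]
  calc ‖a‖ * Metric.infDist x (halfSpace a b) ≤ ‖a‖ * (t * ‖a‖) := by
        rw [← hdist]
        gcongr
        exact Metric.infDist_le_dist_of_mem hmem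
    _ = inner ℝ a x - b := by rw [← htm]; ring

theorem sub_le_mul_infDist {C : Set (E d)} (hC : C.Nonempty) (hCa : C ⊆ halfSpace a b) :
    inner ℝ a x - b ≤ ‖a‖ * Metric.infDist x C := by
  by_cases ha : a = 0
  · obtain ⟨w, hw⟩ := hC
    have hwb : inner ℝ a w ≤ b := hCa hw
    simp only [ha, inner_zero_left, norm_zero, zero_mul] at hwb ⊢
    linarith
  · have hna : 0 < ‖a‖ := norm_pos_iff.2 ha
    rw [← div_le_iff₀' hna]
    refine (Metric.le_infDist hC).2 fun w hw => ?_
    rw [div_le_iff₀' hna, dist_eq_norm]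
    have hwb : inner ℝ a w ≤ b := hCa hw
    have hcs := real_inner_le_norm a (x - w)
    rw [inner_sub_right] at hcs
    linarith

end HalfSpace

/-! ### Both kinds of oracle force asymptotic feasibility. -/

section Oracles

variable {d : ℕ} {ι : Type*} [Fintype ι] {f : E d → ℝ} {S : Set (E d)} {a : ι → E d} {b : ι → ℝ}

/-- A violation of `i` by `ε` puts the iterate at distance at least `ε / ‖a i‖` from the feasible
region, so the oracle returns some `j` violated by at least `‖a j‖ * φ (ε / ‖a i‖)`. Returned
constraints eventually have smaller violations. -/
theorem IsRun.eventually_inner_lt_of_isSeparationOracle (hf : IsBregman f S) (ha : ∀ i, a i ≠ 0)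
    {r : Trace d ι} (h : IsRun f S a b r) {w : E d} (hw : w ∈ feasible a b) (hwS : w ∈ closure S)
    {Q : E d → Finset ι} (hQ : IsSeparationOracle a b Q) (hout : ∀ ν, r.out ν = Q (r.x ν 0))
    (i : ι) {ε : ℝ} (hε : 0 < ε) :
    ∀ᶠ ν in atTop, inner ℝ (a i) (r.x ν 0) < b i + ε := by
  obtain ⟨φ, -, hmono, -, hpos, hsep⟩ := hQ
  have hna : ∀ j, 0 < ‖a j‖ := fun j => norm_pos_iff.2 (ha j)
  set η := φ (ε / ‖a i‖) with hη
  have hη0 : 0 < η := hpos _ (div_pos hε (hna i))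
  have hall : ∀ᶠ ν in atTop, ∀ j, j ∈ r.out ν → inner ℝ (a j) (r.x ν 0) < b j + ‖a j‖ * η :=
    eventually_all.2 fun j =>
      h.eventually_inner_lt_of_mem_out hf hw hwS j (mul_pos (hna j) hη0)
  filter_upwards [hall] with ν hν
  by_contra! hcon
  have hdist : ε / ‖a i‖ ≤ Metric.infDist (r.x ν 0) (feasible a b) := by
    rw [div_le_iff₀' (hna i)]
    linarith [sub_le_mul_infDist (a := a i) (b := b i) (x := r.x ν 0) ⟨w, hw⟩
      (Set.iInter_subset _ i)]
  rcases hsep (r.x ν 0) with hx | ⟨j, hj, hle⟩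
  · have : inner ℝ (a i) (r.x ν 0) ≤ b i := Set.mem_iInter.1 hx i
    linarith
  · have hηj : η ≤ Metric.infDist (r.x ν 0) (halfSpace (a j) (b j)) :=
      (hmono (div_pos hε (hna i)).le Metric.infDist_nonneg hdist).trans hle
    have hviol : b j ≤ inner ℝ (a j) (r.x ν 0) := by
      by_contra! hlt
      have hmem : r.x ν 0 ∈ halfSpace (a j) (b j) := hlt.le
      rw [Metric.infDist_zero_of_mem hmem] at hηj
      linarith
    have h1 := mul_infDist_halfSpace_le (ha j) hviol
    have h2 := hν j (hout ν ▸ hj)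
    have h3 := mul_le_mul_of_nonneg_left hηj (hna j).le
    linarith

/-- Almost surely, if the iterates visit `V` infinitely often, then the random oracle returns
constraint `i` at infinitely many of these visits. -/
theorem ae_frequently_mem_out {Q : E d → PMF (Finset ι)} {Ω : Type*} {mΩ : MeasurableSpace Ω}
    {P : Measure Ω} [IsProbabilityMeasure P] {ℱ : Filtration ℕ mΩ} {R : Ω → Trace d ι}
    (hQ : IsRandomSeparationOracle Q) (hR : IsRandomRun f S a b Q P ℱ R) (i : ι)
    {V : Set (E d)} (hV : MeasurableSet V) :
    ∀ᵐ ω ∂P, (∃ᶠ ν in atTop, (R ω).x ν 0 ∈ V) →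
      ∃ᶠ ν in atTop, (R ω).x ν 0 ∈ V ∧ i ∈ (R ω).out ν := by
  classical
  obtain ⟨τ, hτ, hτQ⟩ := hQ
  let U : ℕ → Set Ω := fun ν => {ω | (R ω).x ν 0 ∈ V}
  let A : ℕ → Set Ω := fun ν => {ω | i ∈ (R ω).out ν}
  have hU : ∀ ν, MeasurableSet[ℱ ν] (U ν) := fun ν => hR.measurable_x ν hV
  have hAeq : ∀ ν, A ν = ⋃ T ∈ Finset.univ.filter (fun T : Finset ι => i ∈ T),
      {ω | (R ω).out ν = T} := by
    intro ν
    ext ω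
    simp [A]
  have hA : ∀ ν, MeasurableSet[ℱ (ν + 1)] (A ν) := by
    intro ν
    rw [hAeq]
    exact Finset.measurableSet_biUnion _ fun T _ => hR.measurable_out ν T
  -- The index is shifted because the list of iteration `ν` is only known at time `ν + 1`; this
  -- makes `s` adapted, as Lévy's conditional Borel–Cantelli lemma requires.
  let s : ℕ → Set Ω := fun n => n.casesOn ∅ fun ν => U ν ∩ A ν
  have hs : ∀ n, MeasurableSet[ℱ n] (s n) := by
    rintro (_ | ν)
    · exact @MeasurableSet.empty _ (ℱ 0)
    · exact (ℱ.mono (Nat.le_succ ν) _ (hU ν)).inter (hA ν)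
  have hsumQ : ∀ x, τ ≤ ∑ T ∈ Finset.univ.filter (fun T : Finset ι => i ∈ T), (Q x T).toReal := by
    intro x
    have hx := hτQ x i
    rw [PMF.toOuterMeasure_apply_fintype] at hx
    rw [← ENNReal.toReal_sum fun T _ => (Q x).apply_ne_top T, Finset.sum_filter]
    refine (ENNReal.ofReal_le_iff_le_toReal ?_).1 (hx.trans_eq ?_)
    · exact (ENNReal.sum_lt_top.2 fun T _ => by
        split_ifs
        · exact ((Q x).apply_ne_top T).lt_top
        · exact ENNReal.zero_lt_top).ne
    · exact Finset.sum_congr rfl fun T _ => by simp [Set.indicator]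
  have hindA : ∀ ν, (A ν).indicator (1 : Ω → ℝ) =
      ∑ T ∈ Finset.univ.filter (fun T : Finset ι => i ∈ T),
        Set.indicator {ω | (R ω).out ν = T} (fun _ => (1 : ℝ)) := by
    intro ν
    ext ω
    simp [A, Set.indicator]
  have hint : ∀ ν (T : Finset ι),
      Integrable (Set.indicator {ω | (R ω).out ν = T} (fun _ => (1 : ℝ))) P := fun ν T =>
    (integrable_const 1).indicator (ℱ.le _ _ (hR.measurable_out ν T))
  have hcond : ∀ ν, ∀ᵐ ω ∂P,
      (U ν).indicator (fun _ => τ) ω ≤ (P[(s (ν + 1)).indicator (1 : Ω → ℝ) | ℱ ν]) ω := by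
    intro ν
    have h1 : (s (ν + 1)).indicator (1 : Ω → ℝ) = (U ν).indicator ((A ν).indicator 1) :=
      (Set.indicator_indicator _ _ _).symm
    have hintA : Integrable ((A ν).indicator (1 : Ω → ℝ)) P :=
      (integrable_const 1).indicator (ℱ.le _ _ (hA ν))
    have h2 := condExp_indicator (m := ℱ ν) hintA (hU ν)
    have h3 : P[(A ν).indicator (1 : Ω → ℝ) | ℱ ν] =ᵐ[P]
        ∑ T ∈ Finset.univ.filter (fun T : Finset ι => i ∈ T),
          P[Set.indicator {ω | (R ω).out ν = T} (fun _ => (1 : ℝ)) | ℱ ν] := by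
      rw [hindA]
      exact condExp_finsetSum (fun T _ => hint ν T) _
    rw [h1]
    filter_upwards [h2, h3, eventually_all.2 fun T => hR.out_law ν T] with ω h2 h3 h4
    rw [h2]
    by_cases hω : ω ∈ U ν
    · rw [Set.indicator_of_mem hω, Set.indicator_of_mem hω, h3, Finset.sum_apply,
        Finset.sum_congr rfl fun T _ => h4 T]
      exact hsumQ _
    · rw [Set.indicator_of_notMem hω, Set.indicator_of_notMem hω]
  filter_upwards [ae_mem_limsup_atTop_iff P hs, ae_all_iff.2 hcond] with ω hlim hle hfreq
  have hUfreq : ω ∈ limsup U atTop := mem_limsup_iff_frequently_mem.2 hfreq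
  -- Infinitely many visits make the sum of `τ` over visits diverge, and this sum is a lower bound
  -- for the sum of conditional probabilities.
  rw [Set.limsup_eq_tendsto_sum_indicator_atTop hτ] at hUfreq
  have hmem : ω ∈ limsup s atTop := hlim.2
    (tendsto_atTop_mono (fun n => Finset.sum_le_sum fun k _ => hle k) hUfreq)
  rw [← limsup_nat_add s 1, mem_limsup_iff_frequently_mem] at hmem
  exact hmem

theorem IsRandomRun.ae_eventually_inner_lt (hf : IsBregman f S) {w : E d}
    (hw : w ∈ feasible a b) (hwS : w ∈ closure S)
    {Q : E d → PMF (Finset ι)} {Ω : Type*} {mΩ : MeasurableSpace Ω}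
    {P : Measure Ω} [IsProbabilityMeasure P] {ℱ : Filtration ℕ mΩ} {R : Ω → Trace d ι}
    (hQ : IsRandomSeparationOracle Q) (hR : IsRandomRun f S a b Q P ℱ R) :
    ∀ᵐ ω ∂P, ∀ i, ∀ ε > 0, ∀ᶠ ν in atTop, inner ℝ (a i) ((R ω).x ν 0) < b i + ε := by
  -- Countably many tolerances keep the exceptional set null. Violating `i` infinitely often would
  -- make the oracle return `i` at infinitely many violations, where it is asymptotically satisfied.
  have hall : ∀ᵐ ω ∂P, ∀ i (n : ℕ), ∀ᶠ ν in atTop,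
      inner ℝ (a i) ((R ω).x ν 0) < b i + 1 / ((n : ℝ) + 1) := by
    refine ae_all_iff.2 fun i => ae_all_iff.2 fun n => ?_
    have hV : MeasurableSet {x : E d | b i + 1 / ((n : ℝ) + 1) ≤ inner ℝ (a i) x} :=
      (isClosed_le continuous_const (continuous_const.inner continuous_id)).measurableSet
    filter_upwards [ae_frequently_mem_out hQ hR i hV] with ω hω
    by_contra hcon
    rw [not_eventually] at hcon
    obtain ⟨ν, ⟨hge, hi⟩, hlt⟩ := ((hω (hcon.mono fun ν hν => not_lt.1 hν)).and_eventually
      ((hR.isRun ω).eventually_inner_lt_of_mem_out hf hw hwS i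
        (Nat.one_div_pos_of_nat (n := n)))).exists
    exact (hlt hi).not_ge hge
  filter_upwards [hall] with ω hω i ε hε
  obtain ⟨n, hn⟩ := exists_nat_one_div_lt hε
  filter_upwards [hω i n] with ν hν
  linarith

end Oracles

end ProjectForget

theorem mainTheorem3 {d : ℕ} {ι : Type*} [Finite ι]
    (f : ProjectForget.E d → ℝ) (S : Set (ProjectForget.E d))
    (a : ι → ProjectForget.E d) (b : ι → ℝ)
    (hf : ProjectForget.IsBregman f S)
    (ha : ∀ i, a i ≠ 0)
    (hzone : ∀ i, ProjectForget.StronglyZoneConsistent f S (a i) (b i))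
    (xstar : ProjectForget.E d) (hopt : ProjectForget.IsOptimal f S a b xstar) :
    (∀ Q : ProjectForget.E d → Finset ι, ProjectForget.IsSeparationOracle a b Q →
      ∀ r : ProjectForget.Trace d ι, ProjectForget.IsRun f S a b r →
        (∀ ν, r.out ν = Q (r.x ν 0)) →
        ProjectForget.AbandonsInactive a b xstar r) ∧
    (∀ Q : ProjectForget.E d → PMF (Finset ι), ProjectForget.IsRandomSeparationOracle Q →
      ∀ (Ω : Type*) (mΩ : MeasurableSpace Ω) (P : MeasureTheory.Measure Ω)
        (_ : MeasureTheory.IsProbabilityMeasure P) (ℱ : MeasureTheory.Filtration ℕ mΩ)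
        (R : Ω → ProjectForget.Trace d ι), ProjectForget.IsRandomRun f S a b Q P ℱ R →
        ∀ᵐ ω ∂P, ProjectForget.AbandonsInactive a b xstar (R ω)) := by
  cases nonempty_fintype ι
  obtain ⟨hw, hwS⟩ := hopt.1
  refine ⟨fun Q hQ r hr hout => ?_, fun Q hQ Ω mΩ P _ ℱ R hR => ?_⟩
  · exact hr.abandonsInactive hf hopt fun i ε hε =>
      hr.eventually_inner_lt_of_isSeparationOracle hf ha hw hwS hQ hout i hε
  · filter_upwards [hR.ae_eventually_inner_lt hf hw hwS hQ] with ω hω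
    exact (hR.isRun ω).abandonsInactive hf hopt hω
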